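/- Let $d,m\in\mathbb{N}$ and let $S_1,\dots,S_m:\mathbb{R}^d\to\mathbb{R}^d$ be contracting similarities, $S_i(x)=r_iT_i(x)+v_i$ with $0<r_i<1$, $T_i$ an orthogonal transformation of $\mathbb{R}^d$ and $v_i\in\mathbb{R}^d$. Let $K\subseteq\mathbb{R}^d$ be the attractor of $\{S_i\}_{i=1}^m$, i.e. the unique nonempty compact set with $K=\bigcup_{i=1}^m S_i(K)$, and assume that $K$ has at least two points. Let $s$ be the similarity dimension, i.e. the unique real number with $\sum_{i=1}^m r_i^s=1$. Assume that the group $\mathcal{T}$ generated by $T_1,\dots,T_m$ is finite, and let $l\in\mathbb{N}$ with $l<d$. Then there exists an $l$-dimensional linear subspace $M\subseteq\mathbb{R}^d$ such that $\dim_H(\Pi_M(K))<s$, where $\Pi_M$ is the orthogonal projection onto $M$ and $\dim_H$ denotes Hausdorff dimension. -/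

import Mathlib

/-- A contracting similarity of `ℝ^d`: a map multiplying all distances by one `r ∈ (0, 1)`. -/
def IsContractingSimilarity {d : ℕ}
    (f : EuclideanSpace ℝ (Fin d) → EuclideanSpace ℝ (Fin d)) : Prop :=
  ∃ r : ℝ, 0 < r ∧ r < 1 ∧ ∀ x y, dist (f x) (f y) = r * dist x y

/-- A contracting similarity of `ℝ^d` has the form `x ↦ r T x + v`, with `0 < r < 1` and `T`
orthogonal. -/
theorem IsContractingSimilarity.exists_decomp {d : ℕ}
    {f : EuclideanSpace ℝ (Fin d) → EuclideanSpace ℝ (Fin d)}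
    (hf : IsContractingSimilarity f) :
    ∃ (r : ℝ) (T : EuclideanSpace ℝ (Fin d) ≃ₗᵢ[ℝ] EuclideanSpace ℝ (Fin d))
      (v : EuclideanSpace ℝ (Fin d)), 0 < r ∧ r < 1 ∧ ∀ x, f x = r • T x + v := by
  obtain ⟨r, h0, h1, h⟩ := hf
  have hi : Isometry (fun x => r⁻¹ • (f x - f 0)) := by
    refine Isometry.of_dist_eq fun x y => ?_
    rw [dist_smul₀, dist_sub_right, h, Real.norm_of_nonneg (inv_nonneg.2 h0.le)]
    field_simp
  let A := hi.affineIsometryOfStrictConvexSpace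
  have hA : ∀ x, A x = r⁻¹ • (f x - f 0) := fun x => rfl
  refine ⟨r, A.linearIsometry.toLinearIsometryEquiv rfl, f 0, h0, h1, fun x => ?_⟩
  have h2 : A.linearIsometry x = A x := by
    have h3 := A.map_vadd 0 x
    rw [hA 0] at h3
    simpa using h3.symm
  rw [LinearIsometry.coe_toLinearIsometryEquiv, h2, hA, smul_inv_smul₀ h0.ne']
  abel

/-- For `d > 0` the decomposition `x ↦ r T x + v` is unique. -/
theorem decomp_unique {d : ℕ} (hd : 0 < d) {r r' : ℝ}
    {T T' : EuclideanSpace ℝ (Fin d) ≃ₗᵢ[ℝ] EuclideanSpace ℝ (Fin d)}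
    {v v' : EuclideanSpace ℝ (Fin d)} (hr : 0 < r) (hr' : 0 < r')
    (h : ∀ x, r • T x + v = r' • T' x + v') : r = r' ∧ T = T' ∧ v = v' := by
  have hv : v = v' := by simpa using h 0
  subst hv
  have h' : ∀ x, r • T x = r' • T' x := fun x => add_right_cancel (h x)
  have hrr : r = r' := by
    have h2 := congrArg norm (h' (EuclideanSpace.single ⟨0, hd⟩ (1 : ℝ)))
    simpa [norm_smul, abs_of_pos hr, abs_of_pos hr'] using h2
  subst hrr
  exact ⟨rfl, LinearIsometryEquiv.ext fun x => smul_right_injective _ hr.ne' (h' x), rfl⟩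

/-- A self-similar iterated function system in `ℝ^d` with `m` maps. -/
structure SSIFS (d m : ℕ) where
  /-- The maps `S_1, …, S_m`. -/
  map : Fin m → EuclideanSpace ℝ (Fin d) → EuclideanSpace ℝ (Fin d)
  isContractingSimilarity : ∀ i, IsContractingSimilarity (map i)

namespace SSIFS

/-- The similarity ratio `r_i` in `S_i x = r_i T_i x + v_i`. -/
noncomputable def ratio {d m : ℕ} (F : SSIFS d m) (i : Fin m) : ℝ :=
  (F.isContractingSimilarity i).exists_decomp.choose

/-- The orthogonal part `T_i` in `S_i x = r_i T_i x + v_i`. -/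
noncomputable def orth {d m : ℕ} (F : SSIFS d m) (i : Fin m) :
    EuclideanSpace ℝ (Fin d) ≃ₗᵢ[ℝ] EuclideanSpace ℝ (Fin d) :=
  (F.isContractingSimilarity i).exists_decomp.choose_spec.choose

/-- The translation `v_i` in `S_i x = r_i T_i x + v_i`. -/
noncomputable def trans {d m : ℕ} (F : SSIFS d m) (i : Fin m) : EuclideanSpace ℝ (Fin d) :=
  (F.isContractingSimilarity i).exists_decomp.choose_spec.choose_spec.choose

theorem decomp {d m : ℕ} (F : SSIFS d m) (i : Fin m) :
    0 < F.ratio i ∧ F.ratio i < 1 ∧ ∀ x, F.map i x = F.ratio i • F.orth i x + F.trans i :=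
  (F.isContractingSimilarity i).exists_decomp.choose_spec.choose_spec.choose_spec

/-- The transformation group, generated by the orthogonal parts `T_1, …, T_m`. -/
noncomputable def transformationGroup {d m : ℕ} (F : SSIFS d m) :
    Subgroup (EuclideanSpace ℝ (Fin d) ≃ₗᵢ[ℝ] EuclideanSpace ℝ (Fin d)) :=
  Subgroup.closure (Set.range F.orth)

/-- `K` is the attractor: the (unique) nonempty compact set with `K = ⋃ i, S_i(K)`. -/
def IsAttractor {d m : ℕ} (F : SSIFS d m) (K : Set (EuclideanSpace ℝ (Fin d))) : Prop :=
  K.Nonempty ∧ IsCompact K ∧ K = ⋃ i, F.map i '' K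

/-- `s` is the similarity dimension: the (unique) solution of `∑ i, r_i ^ s = 1`. -/
def IsSimilarityDimension {d m : ℕ} (F : SSIFS d m) (s : ℝ) : Prop :=
  ∑ i, F.ratio i ^ s = 1

end SSIFS

/-! Finiteness of the group yields two distinct words `w₀`, `w₁` of equal length and ratio, both
with trivial orthogonal part (`SSIFS.exists_words`). Their maps differ only by a translation, so the
two copies of `K` have the same projection to any `M` orthogonal to that translation vector. To turn
this one coincidence into a drop of dimension, consider all the sets `Π_M (g K)`, with `g` in the
group. Since `g ∘ S_w` has orthogonal part `g T_w`, each of them is covered by scaled copies of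
others: a graph-directed system with finitely many vertices. At vertex `g`, pick a word `u` with
`T_u = g⁻¹` (`SSIFS.exists_wordOrth_eq`). The pieces of `u w₀` and `u w₁` coincide under `Π_M ∘ g`,
so one can be dropped and the sum of the `r_w ^ s` at `g` falls below 1. As there are finitely many
vertices, all sums remain below 1 for some exponent `t < s`, and natural covers give dimension at
most `t` (`dimH_graphDirected_lt`). -/

/-! ### Dimension of graph-directed systems -/

open MeasureTheory Filter Topology ENNReal NNReal in
/-- Natural covers of a graph-directed family of sets: iterating the defining inclusions `n` times
gives finite covers by sets of small diameter with controlled `t`-sums. -/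
theorem exists_graphDirected_cover {G X : Type*} [PseudoEMetricSpace X] {β : G → Type}
    [∀ g, Fintype (β g)] (K : G → Set X) (ρ : ∀ g, β g → ℝ≥0) (τ : ∀ g, β g → G)
    (f : ∀ g, β g → X → X) (hf : ∀ g b, LipschitzWith (ρ g b) (f g b))
    (hK : ∀ g, K g ⊆ ⋃ b, f g b '' K (τ g b)) {q : ℝ≥0} (hq : ∀ g b, ρ g b ≤ q)
    {t : ℝ} (ht : 0 ≤ t) (hsum : ∀ g, ∑ b, ρ g b ^ t ≤ 1) {D : ℝ≥0∞}
    (hD : ∀ g, Metric.ediam (K g) ≤ D) (n : ℕ) (g : G) :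
    ∃ (ι : Type) (_ : Fintype ι) (C : ι → Set X), K g ⊆ ⋃ i, C i ∧
      (∀ i, Metric.ediam (C i) ≤ (q : ℝ≥0∞) ^ n * D) ∧
      ∑ i, Metric.ediam (C i) ^ t ≤ D ^ t := by
  induction n generalizing g with
  | zero =>
    refine ⟨Unit, inferInstance, fun _ => K g, fun x hx => Set.mem_iUnion.2 ⟨(), hx⟩, ?_, ?_⟩
    · simpa using hD g
    · simpa using ENNReal.rpow_le_rpow (hD g) ht
  | succ n ih =>
    choose ι hι C hC hdiam hC' using ih
    refine ⟨Σ b : β g, ι (τ g b), inferInstance, fun x => f g x.1 '' C _ x.2, ?_, ?_, ?_⟩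
    · intro x hx
      obtain ⟨b, y, hy, rfl⟩ := Set.mem_iUnion.1 (hK g hx)
      obtain ⟨i, hi⟩ := Set.mem_iUnion.1 (hC _ hy)
      exact Set.mem_iUnion.2 ⟨⟨b, i⟩, y, hi, rfl⟩
    · rintro ⟨b, i⟩
      calc Metric.ediam (f g b '' C _ i) ≤ ρ g b * Metric.ediam (C _ i) :=
            (hf g b).ediam_image_le _
        _ ≤ q * ((q : ℝ≥0∞) ^ n * D) := by
            gcongr
            · exact hq g b
            · exact hdiam _ i
        _ = _ := by rw [pow_succ', mul_assoc]
    · rw [Fintype.sum_sigma]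
      calc ∑ b, ∑ i, Metric.ediam (f g b '' C _ i) ^ t
          ≤ ∑ b, ∑ i, (ρ g b : ℝ≥0∞) ^ t * Metric.ediam (C (τ g b) i) ^ t := by
            gcongr with b _ i _
            rw [← ENNReal.mul_rpow_of_nonneg _ _ ht]
            exact ENNReal.rpow_le_rpow ((hf g b).ediam_image_le _) ht
        _ ≤ ∑ b, (ρ g b : ℝ≥0∞) ^ t * D ^ t := by
            gcongr with b _
            rw [← Finset.mul_sum]
            gcongr
            exact hC' _
        _ = ((∑ b, ρ g b ^ t : ℝ≥0) : ℝ≥0∞) * D ^ t := by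
            rw [← Finset.sum_mul, ENNReal.ofNNReal_finsetSum]
            simp_rw [ENNReal.coe_rpow_of_nonneg _ ht]
        _ ≤ 1 * D ^ t := by
            gcongr
            exact_mod_cast hsum g
        _ = D ^ t := one_mul _

open MeasureTheory Filter Topology ENNReal NNReal in
/-- Upper bound for the Hausdorff dimension of the sets of a graph-directed system. -/
theorem dimH_graphDirected_le {G X : Type*} [EMetricSpace X] {β : G → Type}
    [∀ g, Fintype (β g)] (K : G → Set X) (ρ : ∀ g, β g → ℝ≥0) (τ : ∀ g, β g → G)
    (f : ∀ g, β g → X → X) (hf : ∀ g b, LipschitzWith (ρ g b) (f g b))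
    (hK : ∀ g, K g ⊆ ⋃ b, f g b '' K (τ g b)) {q : ℝ≥0} (hq1 : q < 1) (hq : ∀ g b, ρ g b ≤ q)
    {t : ℝ≥0} (hsum : ∀ g, ∑ b, ρ g b ^ (t : ℝ) ≤ 1) {D : ℝ≥0∞} (hDtop : D ≠ ∞)
    (hD : ∀ g, Metric.ediam (K g) ≤ D) (g : G) : dimH (K g) ≤ t := by
  borelize X
  choose ι hι C hC hdiam hC' using fun n =>
    exists_graphDirected_cover K ρ τ f hf hK hq t.2 hsum hD n g
  apply dimH_le_of_hausdorffMeasure_ne_top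
  have hr : Tendsto (fun n => (q : ℝ≥0∞) ^ n * D) atTop (𝓝 0) := by
    simpa using ENNReal.Tendsto.mul_const
      (ENNReal.tendsto_pow_atTop_nhds_zero_of_lt_one (by exact_mod_cast hq1)) (Or.inr hDtop)
  have h := Measure.hausdorffMeasure_le_liminf_sum (t : ℝ) (K g) _ hr C
    (Eventually.of_forall hdiam) (Eventually.of_forall hC)
  refine ne_top_of_le_ne_top (ENNReal.rpow_ne_top_of_nonneg t.2 hDtop) (h.trans ?_)
  exact liminf_le_of_le (by isBoundedDefault) fun b hb =>
    (hb.exists.choose_spec).trans (hC' _)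

open MeasureTheory Filter Topology ENNReal NNReal in
/-- If all `s`-sums of a finite graph-directed system are less than one, then its sets have
Hausdorff dimension less than `s`. -/
theorem dimH_graphDirected_lt {G X : Type*} [Finite G] [EMetricSpace X] {β : G → Type}
    [∀ g, Fintype (β g)] (K : G → Set X) (ρ : ∀ g, β g → ℝ≥0) (τ : ∀ g, β g → G)
    (f : ∀ g, β g → X → X) (hf : ∀ g b, LipschitzWith (ρ g b) (f g b))
    (hK : ∀ g, K g ⊆ ⋃ b, f g b '' K (τ g b)) (hρ0 : ∀ g b, 0 < ρ g b)
    (hρ : ∀ g b, ρ g b < 1) {s : ℝ} (hs : 0 < s) (hsum : ∀ g, ∑ b, ρ g b ^ s < 1)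
    (hD : ∀ g, Metric.ediam (K g) ≠ ∞) (g : G) : dimH (K g) < ENNReal.ofReal s := by
  cases nonempty_fintype G
  -- Each sum is continuous in the exponent, and finiteness of `G` allows one `t < s` for all
  -- vertices.
  have hcont : ∀ᶠ t in 𝓝[<] s, ∀ g, ∑ b, ρ g b ^ t < 1 := by
    refine nhdsWithin_le_nhds (eventually_all.2 fun g => ?_)
    refine Tendsto.eventually_lt_const (hsum g) (tendsto_finsetSum _ fun b _ => ?_)
    exact (NNReal.continuousAt_rpow (Or.inl (hρ0 g b).ne')).tendsto.comp
      (tendsto_const_nhds.prodMk_nhds tendsto_id)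
  obtain ⟨t, hts, ht0, hts'⟩ :=
    (hcont.and (((lt_mem_nhds hs).filter_mono nhdsWithin_le_nhds).and self_mem_nhdsWithin)).exists
  lift t to ℝ≥0 using ht0.le
  obtain ⟨q, hq1, hq⟩ : ∃ q : ℝ≥0, q < 1 ∧ ∀ g b, ρ g b ≤ q := by
    refine ⟨Finset.univ.sup fun x : Σ g, β g => ρ x.1 x.2, ?_, fun g b => ?_⟩
    · exact (Finset.sup_lt_iff one_pos).2 fun x _ => hρ _ _
    · exact Finset.le_sup (f := fun x : Σ g, β g => ρ x.1 x.2) (Finset.mem_univ ⟨g, b⟩)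
  have h := dimH_graphDirected_le K ρ τ f hf hK hq1 hq (fun g => (hts g).le)
    (D := ∑ g, Metric.ediam (K g)) (ENNReal.sum_ne_top.2 fun g _ => hD g)
    (fun g => Finset.single_le_sum (f := fun g => Metric.ediam (K g)) (fun _ _ => zero_le)
      (Finset.mem_univ g)) g
  refine h.trans_lt ?_
  rw [← ENNReal.ofReal_coe_nnreal]
  exact (ENNReal.ofReal_lt_ofReal_iff hs).2 hts'

/-- A subspace of dimension `l < d` orthogonal to a given vector. -/
theorem exists_submodule_finrank_eq_mem_orthogonal {d l : ℕ} (hl : l < d)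
    (v : EuclideanSpace ℝ (Fin d)) :
    ∃ M : Submodule ℝ (EuclideanSpace ℝ (Fin d)), Module.finrank ℝ M = l ∧ v ∈ Mᗮ := by
  have h1 := (ℝ ∙ v).finrank_add_finrank_orthogonal
  rw [finrank_euclideanSpace_fin] at h1
  -- The vector `v` may be zero, so its span has dimension at most one; the complement still has
  -- dimension at least `d - 1 ≥ l`.
  have h2 := finrank_span_le_card (R := ℝ) ({v} : Set (EuclideanSpace ℝ (Fin d)))
  rw [Set.toFinset_singleton, Finset.card_singleton] at h2
  obtain ⟨f, hf⟩ := exists_linearIndependent_of_le_finrank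
    (R := ℝ) (M := (ℝ ∙ v)ᗮ) (n := l) (by omega)
  have hf' := hf.map' (ℝ ∙ v)ᗮ.subtype (Submodule.ker_subtype _)
  refine ⟨Submodule.span ℝ (Set.range ((ℝ ∙ v)ᗮ.subtype ∘ f)), ?_, ?_⟩
  · simpa using finrank_span_eq_card hf'
  · have hle : Submodule.span ℝ (Set.range ((ℝ ∙ v)ᗮ.subtype ∘ f)) ≤ (ℝ ∙ v)ᗮ :=
      Submodule.span_le.2 (by rintro _ ⟨i, rfl⟩; exact (f i).2)
    exact Submodule.orthogonal_le hle
      (Submodule.le_orthogonal_orthogonal _ (Submodule.mem_span_singleton_self v))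

/-! ### Words in the maps of the system -/

namespace SSIFS

variable {d m : ℕ}

/-- The composition `S_{w_1} ∘ ⋯ ∘ S_{w_n}` along a word `w`. -/
def wordMap (F : SSIFS d m) (w : List (Fin m)) (x : EuclideanSpace ℝ (Fin d)) :
    EuclideanSpace ℝ (Fin d) :=
  w.foldr F.map x

/-- The product of the similarity ratios along a word. -/
noncomputable def wordRatio (F : SSIFS d m) (w : List (Fin m)) : ℝ := (w.map F.ratio).prod

/-- The product of the orthogonal parts along a word. -/
noncomputable def wordOrth (F : SSIFS d m) (w : List (Fin m)) :
    EuclideanSpace ℝ (Fin d) ≃ₗᵢ[ℝ] EuclideanSpace ℝ (Fin d) :=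
  (w.map F.orth).prod

theorem wordMap_append (F : SSIFS d m) (u w : List (Fin m)) (x : EuclideanSpace ℝ (Fin d)) :
    F.wordMap (u ++ w) x = F.wordMap u (F.wordMap w x) :=
  List.foldr_append

theorem wordMap_eq (F : SSIFS d m) (w : List (Fin m)) (x : EuclideanSpace ℝ (Fin d)) :
    F.wordMap w x = F.wordRatio w • F.wordOrth w x + F.wordMap w 0 := by
  induction w generalizing x with
  | nil => simp [wordMap, wordRatio, wordOrth]
  | cons i w ih =>
    have h (y) : F.wordMap (i :: w) y = F.ratio i • F.orth i (F.wordMap w y) + F.trans i :=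
      (F.decomp i).2.2 _
    rw [h, h, ih]
    simp only [wordRatio, wordOrth, List.map_cons, List.prod_cons, map_add, map_smul,
      LinearIsometryEquiv.coe_mul, Function.comp_apply, smul_add, smul_smul]
    abel

theorem wordRatio_append (F : SSIFS d m) (u w : List (Fin m)) :
    F.wordRatio (u ++ w) = F.wordRatio u * F.wordRatio w := by
  simp [wordRatio]

theorem wordOrth_append (F : SSIFS d m) (u w : List (Fin m)) :
    F.wordOrth (u ++ w) = F.wordOrth u * F.wordOrth w := by
  simp [wordOrth]

theorem wordOrth_replicate (F : SSIFS d m) (n : ℕ) (i : Fin m) :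
    F.wordOrth (List.replicate n i) = F.orth i ^ n := by
  simp [wordOrth]

theorem wordRatio_pos (F : SSIFS d m) (w : List (Fin m)) : 0 < F.wordRatio w :=
  List.prod_pos (by simpa using fun i _ => (F.decomp i).1)

theorem wordRatio_lt_one (F : SSIFS d m) {w : List (Fin m)} (hw : w ≠ []) :
    F.wordRatio w < 1 := by
  induction w with
  | nil => exact absurd rfl hw
  | cons i w ih =>
    have h1 : F.wordRatio w ≤ 1 := by
      rcases eq_or_ne w [] with rfl | h
      · simp [wordRatio]
      · exact (ih h).le
    calc F.wordRatio (i :: w) = F.ratio i * F.wordRatio w := by simp [wordRatio]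
      _ ≤ F.ratio i := mul_le_of_le_one_right (F.decomp i).1.le h1
      _ < 1 := (F.decomp i).2.1

theorem wordOrth_mem (F : SSIFS d m) (w : List (Fin m)) :
    F.wordOrth w ∈ F.transformationGroup :=
  Subgroup.list_prod_mem _ fun _ hx => by
    obtain ⟨i, _, rfl⟩ := List.mem_map.1 hx
    exact Subgroup.subset_closure ⟨i, rfl⟩

/-- Expand the `n`-th power of `∑ i, r_i ^ s = 1`. -/
theorem sum_wordRatio_rpow (F : SSIFS d m) {s : ℝ} (hs : F.IsSimilarityDimension s) (n : ℕ) :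
    ∑ w : Fin n → Fin m, F.wordRatio (List.ofFn w) ^ s = 1 := by
  have h := Fintype.sum_pow (fun i => F.ratio i ^ s) n
  rw [show ∑ i, F.ratio i ^ s = 1 from hs, one_pow] at h
  rw [h]
  refine Finset.sum_congr rfl fun w _ => ?_
  rw [Real.finsetProd_rpow _ _ fun i _ => (F.decomp _).1.le, wordRatio, List.map_ofFn,
    List.prod_ofFn]
  rfl

theorem IsAttractor.exists_wordMap {F : SSIFS d m} {K : Set (EuclideanSpace ℝ (Fin d))}
    (hK : F.IsAttractor K) (n : ℕ) {x : EuclideanSpace ℝ (Fin d)} (hx : x ∈ K) :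
    ∃ w : Fin n → Fin m, ∃ y ∈ K, F.wordMap (List.ofFn w) y = x := by
  induction n generalizing x with
  | zero => exact ⟨Fin.elim0, x, hx, by simp [wordMap]⟩
  | succ n ih =>
    rw [hK.2.2] at hx
    obtain ⟨i, y, hy, rfl⟩ := Set.mem_iUnion.1 hx
    obtain ⟨w, z, hz, rfl⟩ := ih hy
    exact ⟨Fin.cons i w, z, hz, by simp [wordMap, List.ofFn_succ]⟩

/-- An attractor with at least two points needs two maps. -/
theorem IsAttractor.exists_ne {F : SSIFS d m} {K : Set (EuclideanSpace ℝ (Fin d))}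
    (hK : F.IsAttractor K) (hK2 : K.Nontrivial) : ∃ a b : Fin m, a ≠ b := by
  by_contra! h
  obtain ⟨x, hx, y, hy, hxy⟩ := hK2
  have hK' := hK.2.2
  have hne : ∃ a : Fin m, True := by
    rw [hK'] at hx
    obtain ⟨i, _⟩ := Set.mem_iUnion.1 hx
    exact ⟨i, trivial⟩
  obtain ⟨a, -⟩ := hne
  obtain ⟨r, hr0, hr1, hr⟩ := F.isContractingSimilarity a
  have hKa : K ⊆ F.map a '' K := fun z hz => by
    rw [hK'] at hz
    obtain ⟨i, hi⟩ := Set.mem_iUnion.1 hz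
    rwa [h a i]
  have hdiam : Metric.diam K ≤ r * Metric.diam K := by
    refine Metric.diam_le_of_forall_dist_le (mul_nonneg hr0.le Metric.diam_nonneg) ?_
    intro z hz w hw
    obtain ⟨z', hz', rfl⟩ := hKa hz
    obtain ⟨w', hw', rfl⟩ := hKa hw
    rw [hr]
    gcongr
    exact Metric.dist_le_diam_of_mem hK.2.1.isBounded hz' hw'
  have hpos : 0 < Metric.diam K :=
    (dist_pos.2 hxy).trans_le (Metric.dist_le_diam_of_mem hK.2.1.isBounded hx hy)
  nlinarith

/-- For `s ≤ 0` every term would be at least 1, and two of them already exceed the sum. -/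
theorem IsSimilarityDimension.pos {F : SSIFS d m} {s : ℝ} (hs : F.IsSimilarityDimension s)
    {a b : Fin m} (hab : a ≠ b) : 0 < s := by
  by_contra! h
  have h1 : ∀ i, 1 ≤ F.ratio i ^ s := fun i =>
    Real.one_le_rpow_of_pos_of_le_one_of_nonpos (F.decomp i).1 (F.decomp i).2.1.le h
  have h2 : ∑ i ∈ {a, b}, F.ratio i ^ s ≤ ∑ i, F.ratio i ^ s :=
    Finset.sum_le_univ_sum_of_nonneg fun i => zero_le_one.trans (h1 i)
  rw [show ∑ i, F.ratio i ^ s = 1 from hs, Finset.sum_pair hab] at h2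
  linarith [h1 a, h1 b]

/-- Words give only products of generators, without inverses; this suffices because generators of
finite order have their inverses among their powers. -/
theorem exists_wordOrth_eq (F : SSIFS d m) (hfin : Finite F.transformationGroup)
    {g : EuclideanSpace ℝ (Fin d) ≃ₗᵢ[ℝ] EuclideanSpace ℝ (Fin d)}
    (hg : g ∈ F.transformationGroup) : ∃ w, F.wordOrth w = g := by
  have hfo : ∀ x ∈ Set.range F.orth, IsOfFinOrder x := fun x hx =>
    F.transformationGroup.isOfFinOrder_coe.2
      (isOfFinOrder_of_finite (⟨x, Subgroup.subset_closure hx⟩ : F.transformationGroup))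
  have hg' : g ∈ Submonoid.closure (Set.range F.orth) := by
    rw [← Subgroup.closure_toSubmonoid_of_isOfFinOrder hfo]
    exact hg
  obtain ⟨w, hw, rfl⟩ := Submonoid.exists_list_of_mem_closure hg'
  obtain ⟨w', rfl⟩ : w ∈ Set.range (List.map F.orth) := by
    rw [Set.range_list_map]
    exact hw
  exact ⟨w', rfl⟩

/-- If the transformation group is finite, there are two distinct words of the same length with
trivial orthogonal part and the same ratio. -/
theorem exists_words (F : SSIFS d m) (hfin : Finite F.transformationGroup) {a b : Fin m}
    (hab : a ≠ b) : ∃ w₀ w₁ : List (Fin m), w₀ ≠ w₁ ∧ w₀ ≠ [] ∧ w₀.length = w₁.length ∧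
      F.wordOrth w₀ = 1 ∧ F.wordOrth w₁ = 1 ∧ F.wordRatio w₀ = F.wordRatio w₁ := by
  have hp : ∀ i, F.orth i ^ Nat.card F.transformationGroup = 1 := fun i =>
    congrArg Subtype.val (pow_card_eq_one' (G := F.transformationGroup)
      (x := ⟨F.orth i, Subgroup.subset_closure ⟨i, rfl⟩⟩))
  obtain ⟨n, hn⟩ := Nat.exists_eq_succ_of_ne_zero
    (Nat.card_pos (α := F.transformationGroup)).ne'
  rw [hn] at hp
  -- With `p = n + 1` the group order, every `T_i ^ p` is trivial. The words `b^p a^p` and `a^p b^p`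
  -- use the same letters, hence have equal ratios, but begin differently.
  refine ⟨List.replicate (n + 1) b ++ List.replicate (n + 1) a,
    List.replicate (n + 1) a ++ List.replicate (n + 1) b, ?_, ?_, by simp, ?_, ?_, ?_⟩
  · simp [List.replicate_succ, hab.symm]
  · simp
  · simp [wordOrth_append, wordOrth_replicate, hp]
  · simp [wordOrth_append, wordOrth_replicate, hp]
  · rw [wordRatio_append, wordRatio_append, mul_comm]

end SSIFS

/-- If the transformation group of a self-similar iterated function system in `ℝ^d` is finite and
`l < d`, then the orthogonal projection of the attractor (assumed to have at least two points) to
some `l`-dimensional subspace has Hausdorff dimension less than the similarity dimension. -/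
theorem mainTheorem5 {d m : ℕ} (F : SSIFS d m) (K : Set (EuclideanSpace ℝ (Fin d)))
    (hK : F.IsAttractor K) (hK2 : K.Nontrivial) (s : ℝ) (hs : F.IsSimilarityDimension s)
    (hfin : Finite F.transformationGroup) (l : ℕ) (hl : l < d) :
    ∃ M : Submodule ℝ (EuclideanSpace ℝ (Fin d)),
      Module.finrank ℝ M = l ∧ dimH (M.starProjection '' K) < ENNReal.ofReal s := by
  obtain ⟨a, b, hab⟩ := hK.exists_ne hK2
  obtain ⟨w₀, w₁, hne, hnil, hlen, hT₀, hT₁, hr⟩ := F.exists_words hfin hab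
  obtain ⟨M, hM, hv⟩ := exists_submodule_finrank_eq_mem_orthogonal hl
    (F.wordMap w₀ 0 - F.wordMap w₁ 0)
  refine ⟨M, hM, ?_⟩
  have hP (c : ℝ) (x) : M.starProjection (c • F.wordMap w₀ x) =
      M.starProjection (c • F.wordMap w₁ x) := by
    rw [← sub_eq_zero, ← map_sub, ← smul_sub, map_smul, F.wordMap_eq w₀, F.wordMap_eq w₁, hT₀,
      hT₁, hr, add_sub_add_left_eq_sub, (Submodule.starProjection_apply_eq_zero_iff _).2 hv, smul_zero]
  have hs0 := hs.pos hab
  -- The word `u g` has orthogonal part `g⁻¹`, which cancels `g` in front of it, so that `hP`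
  -- applies directly to what follows `u g`.
  choose u hu using fun g : F.transformationGroup =>
    F.exists_wordOrth_eq hfin (F.transformationGroup.inv_mem g.2)
  let N (g : F.transformationGroup) : ℕ := (u g ++ w₀).length
  have hN (g : F.transformationGroup) : N g = (u g ++ w₁).length := by simp [N, hlen]
  obtain ⟨bad, hbad⟩ : ∃ bad : ∀ g, Fin (N g) → Fin m, ∀ g, List.ofFn (bad g) = u g ++ w₀ :=
    ⟨fun g => (u g ++ w₀).get, fun g => List.ofFn_get _⟩
  obtain ⟨good, hgood⟩ : ∃ good : ∀ g, Fin (N g) → Fin m, ∀ g, List.ofFn (good g) = u g ++ w₁ :=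
    ⟨fun g i => (u g ++ w₁).get (i.cast (hN g)), fun g => by
      rw [← List.ofFn_congr (hN g).symm, List.ofFn_get]⟩
  have hgb (g) : good g ≠ bad g := fun h => hne <| List.append_cancel_left
    ((hbad g).symm.trans ((congrArg List.ofFn h.symm).trans (hgood g)))
  have hρ0 (w) : 0 ≤ F.wordRatio w := (F.wordRatio_pos w).le
  -- The edges at `g` are all words of length `N g` except `bad g`; the vertex `1` gives the
  -- projection of `K` itself.
  have key := dimH_graphDirected_lt (G := F.transformationGroup)
    (β := fun g => {w : Fin (N g) → Fin m // w ≠ bad g})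
    (fun g => (fun x => M.starProjection (g.1 x)) '' K)
    (fun g w => ⟨F.wordRatio (List.ofFn w.1), hρ0 _⟩)
    (fun g w => g * ⟨F.wordOrth (List.ofFn w.1), F.wordOrth_mem _⟩)
    (fun g w x => F.wordRatio (List.ofFn w.1) • x +
      M.starProjection (g.1 (F.wordMap (List.ofFn w.1) 0)))
    ?_ ?_ (fun g w => F.wordRatio_pos _) ?_ hs0 ?_ ?_ 1
  · simpa using key
  · intro g w
    refine LipschitzWith.of_dist_le_mul fun x y => ?_
    rw [dist_add_right, dist_smul₀, Real.norm_of_nonneg (hρ0 _)]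
    rfl
  · rintro g _ ⟨x, hx, rfl⟩
    obtain ⟨w, y, hy, hwy, hw⟩ : ∃ w : Fin (N g) → Fin m, ∃ y ∈ K,
        M.starProjection (g.1 (F.wordMap (List.ofFn w) y)) = M.starProjection (g.1 x) ∧
        w ≠ bad g := by
      obtain ⟨w, y, hy, rfl⟩ := hK.exists_wordMap (N g) hx
      rcases eq_or_ne w (bad g) with rfl | hw
      -- A point coded by the bad word has the same image as the point coded by the good word with
      -- the same `y`.
      · refine ⟨good g, y, hy, ?_, hgb g⟩
        have h1 (z) : M.starProjection (g.1 (F.wordMap (u g) z)) =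
            M.starProjection (F.wordRatio (u g) • z) +
              M.starProjection (g.1 (F.wordMap (u g) 0)) := by
          rw [F.wordMap_eq (u g) z, hu, map_add, map_add, map_smul, ← Function.comp_apply (f := g.1), ← LinearIsometryEquiv.coe_mul,
            mul_inv_cancel, LinearIsometryEquiv.coe_one, id_eq]
        rw [hbad, hgood, F.wordMap_append, F.wordMap_append, h1, h1 (F.wordMap w₀ y), hP]
      · exact ⟨w, y, hy, rfl, hw⟩
    refine Set.mem_iUnion.2 ⟨⟨w, hw⟩, _, ⟨y, hy, rfl⟩, ?_⟩
    simp only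
    rw [← hwy, F.wordMap_eq _ y]
    simp
  · intro g w
    refine F.wordRatio_lt_one fun h => ?_
    have h' := congrArg List.length h
    simp [N, hnil] at h'
  · intro g
    -- The sum over all words is 1, and the omitted term is positive.
    have h1 := F.sum_wordRatio_rpow hs (N g)
    rw [← Finset.add_sum_erase _ _ (Finset.mem_univ (bad g)),
      Finset.sum_subtype (p := fun w => w ≠ bad g) _ (by simp)] at h1
    have h2 : 0 < F.wordRatio (List.ofFn (bad g)) ^ s := Real.rpow_pos_of_pos (F.wordRatio_pos _) s
    rw [← NNReal.coe_lt_coe, NNReal.coe_sum]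
    change ∑ w : {w // w ≠ bad g}, F.wordRatio (List.ofFn w.1) ^ s < 1
    linarith
  · intro g
    have hc : Continuous fun x => M.starProjection (g.1 x) := by fun_prop
    exact (hK.2.1.image hc).isBounded.ediam_ne_top
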